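/- Let $\Delta$ be a (closed, geometric) simplex of dimension $k$, regarded as a manifold with corners, let $\mathcal{A}$ be a transitive Lie algebroid on $\Delta$ with anchor $\gamma$, and let $p\ge 0$. For a nonempty face $\alpha$ of $\Delta$ let $\mathcal{A}^{!!}_{\alpha}$ denote the restriction of $\mathcal{A}$ to $\alpha$, that is, the inverse image of $\mathcal A$ under the inclusion $\alpha\hookrightarrow\Delta$; its fibre at $x\in\alpha$ is $\{a\in\mathcal{A}_x : \gamma(a)\in T_x\alpha\}$. Let $\Omega^{p}(\mathcal{A}^{!!}_{\alpha};\alpha)$ be the space of smooth $p$-forms on $\mathcal{A}^{!!}_{\alpha}$, i.e. smooth sections of $\Lambda^p(\mathcal{A}^{!!}_{\alpha})^*$. If $\beta$ is a face of $\alpha$, the restriction to $\beta$ of a form $\eta$ on $\mathcal{A}^{!!}_{\alpha}$ is the form $\eta_{/\beta}$ on $\mathcal{A}^{!!}_{\beta}$ obtained by evaluating $\eta$ at the points of $\beta$ on vectors of $\mathcal{A}^{!!}_{\beta}\subset \mathcal{A}^{!!}_{\alpha}$. A piecewise smooth $p$-form on $\Delta$ is a family $\omega=(\omega_\alpha)_\alpha$,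 indexed by all nonempty faces $\alpha$ of $\Delta$ (including $\Delta$ itself), with $\omega_\alpha\in\Omega^{p}(\mathcal{A}^{!!}_{\alpha};\alpha)$ and $(\omega_\alpha)_{/\beta}=\omega_\beta$ whenever $\beta$ is a face of $\alpha$. Let $J$ be any set of $(k-1)$-dimensional faces of $\Delta$, and for each $\alpha\in J$ let $\xi_\alpha\in\Omega^{p}(\mathcal{A}^{!!}_{\alpha};\alpha)$ be a smooth form, such that for all $\alpha,\beta\in J$ with $\alpha\cap\beta\neq\emptyset$ the forms $\xi_\alpha$ and $\xi_\beta$ have the same restriction to the face $\alpha\cap\beta$. Then there is a piecewise smooth $p$-form $\omega$ on $\Delta$ such that $\omega_{\alpha}=\xi_{\alpha}$ for every $\alpha\in J$. -/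

import Mathlib

open Set Bundle
open scoped Manifold ContDiff Bundle

noncomputable section

/-! ### Lie algebroids and differential forms on their restrictions -/

section LieAlgebroids

/-- A (real, smooth) Lie algebroid on a manifold `M` (possibly with boundary and corners, encoded by
the model with corners `I`), with underlying smooth vector bundle `A → M` of typical fibre `F`:
an anchor `A → TM`, which is a smooth morphism of vector bundles over the identity of `M`, and a
real Lie algebra structure on the space of smooth sections of `A`, such that the map induced by the
anchor on sections is a homomorphism into the Lie algebra of vector fields, and such that
`[X, f Y] = f [X, Y] + (anchor X · f) Y`. -/
structure LieAlgebroid {E : Type*} [NormedAddCommGroup E] [NormedSpace ℝ E]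
    {H : Type*} [TopologicalSpace H] (I : ModelWithCorners ℝ E H)
    {M : Type*} [TopologicalSpace M] [ChartedSpace H M] [IsManifold I ∞ M]
    (F : Type*) [NormedAddCommGroup F] [NormedSpace ℝ F]
    (A : M → Type*) [TopologicalSpace (TotalSpace F A)]
    [∀ x, AddCommGroup (A x)] [∀ x, Module ℝ (A x)] [∀ x, TopologicalSpace (A x)]
    [FiberBundle F A] [VectorBundle ℝ F A] [ContMDiffVectorBundle ∞ F A I] where
  /-- the anchor, fibre by fibre -/
  anchor : ∀ x, A x →ₗ[ℝ] TangentSpace I x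
  /-- the anchor is a smooth map between the total spaces -/
  contMDiff_anchor : ContMDiff (I.prod 𝓘(ℝ, F)) (I.prod 𝓘(ℝ, E)) ∞
    (fun a : TotalSpace F A => (⟨a.proj, anchor a.proj a.2⟩ : TangentBundle I M))
  /-- the bracket of smooth sections -/
  bracket : Cₛ^∞⟮I; F, A⟯ →ₗ[ℝ] Cₛ^∞⟮I; F, A⟯ →ₗ[ℝ] Cₛ^∞⟮I; F, A⟯
  bracket_self : ∀ X, bracket X X = 0
  jacobi : ∀ X Y Z,
    bracket X (bracket Y Z) + bracket Y (bracket Z X) + bracket Z (bracket X Y) = 0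
  anchor_bracket : ∀ (X Y : Cₛ^∞⟮I; F, A⟯) (x : M),
    anchor x (bracket X Y x) =
      VectorField.mlieBracket I (fun y => anchor y (X y)) (fun y => anchor y (Y y)) x
  /-- the Leibniz rule; `fY` is the section `f Y` -/
  leibniz : ∀ (X Y fY : Cₛ^∞⟮I; F, A⟯) (f : M → ℝ), ContMDiff I 𝓘(ℝ, ℝ) ∞ f →
    (∀ x, fY x = f x • Y x) →
    ∀ x, bracket X fY x =
      f x • bracket X Y x + mvfderiv I f x (anchor x (X x)) • Y x

namespace LieAlgebroid

variable {E : Type*} [NormedAddCommGroup E] [NormedSpace ℝ E]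
  {H : Type*} [TopologicalSpace H] {I : ModelWithCorners ℝ E H}
  {M : Type*} [TopologicalSpace M] [ChartedSpace H M] [IsManifold I ∞ M]
  {F : Type*} [NormedAddCommGroup F] [NormedSpace ℝ F]
  {A : M → Type*} [TopologicalSpace (TotalSpace F A)]
  [∀ x, AddCommGroup (A x)] [∀ x, Module ℝ (A x)] [∀ x, TopologicalSpace (A x)]
  [FiberBundle F A] [VectorBundle ℝ F A] [ContMDiffVectorBundle ∞ F A I]

/-- A Lie algebroid is transitive if its anchor is surjective (on every fibre). -/
def IsTransitive (L : LieAlgebroid I F A) : Prop :=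
  ∀ x, Function.Surjective (L.anchor x)

variable {E' : Type*} [NormedAddCommGroup E'] [NormedSpace ℝ E']
  {H' : Type*} [TopologicalSpace H'] (J : ModelWithCorners ℝ E' H')
  {N : Type*} [TopologicalSpace N] [ChartedSpace H' N]

/-- The fibre at `x` of the restriction `φ^!! A` of a Lie algebroid `A` to a submanifold
`φ : N → M`. The inverse image has fibre `{(u, a) ∈ T_x N × A_{φ x} | T_x φ u = anchor a}`; since
`T_x φ` is injective, it is identified, by the projection to the second factor, with the subspace of
the `a ∈ A_{φ x}` whose anchor is tangent to `N`. (Forms on `φ^!! A` and their restrictions involve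
only the vector bundle underlying `φ^!! A`, a smooth subbundle of `A` along `φ`, not its bracket.) -/
def restrictFibre (L : LieAlgebroid I F A) (φ : N → M) (x : N) : Submodule ℝ (A (φ x)) :=
  (LinearMap.range (mfderiv J I φ x : TangentSpace J x →ₗ[ℝ] TangentSpace I (φ x))).comap
    (L.anchor (φ x))

/-- A section `X` of `φ^!! A` (defined at all points of `N`, but to be looked at only on `U`) is
smooth on `U` if it is so as a map from `N` to the total space of `A`. -/
def SmoothSectionOn (L : LieAlgebroid I F A) (φ : N → M) (X : ∀ x, L.restrictFibre J φ x)
    (U : Set N) : Prop :=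
  ContMDiffOn J (I.prod 𝓘(ℝ, F)) ∞
    (fun x => (⟨φ x, (X x : A (φ x))⟩ : TotalSpace F A)) U

/-- `Ω^p(φ^!! A; N)`: the smooth forms of degree `p` on the restriction `φ^!! A`, that is, the
families of alternating `p`-linear forms on the fibres of `φ^!! A` which give a smooth function when
evaluated on smooth local sections of `φ^!! A`; equivalently, the smooth sections of the `p`-th
exterior power of the dual bundle. -/
structure SmoothForm (L : LieAlgebroid I F A) (φ : N → M) (p : ℕ) where
  toFun : ∀ x, (L.restrictFibre J φ x) [⋀^Fin p]→ₗ[ℝ] ℝ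
  smooth : ∀ (U : Set N), IsOpen U → ∀ X : Fin p → ∀ x, L.restrictFibre J φ x,
    (∀ i, L.SmoothSectionOn J φ (X i) U) →
    ContMDiffOn J 𝓘(ℝ, ℝ) ∞ (fun x => toFun x (fun i => X i x)) U

end LieAlgebroid

end LieAlgebroids

/-! ### Simplices and their faces as manifolds with corners -/

section Simplices

/-- The (nonempty) faces of a `k`-simplex, given by their sets of vertices. The order is the
inclusion of faces. -/
abbrev SimplexFace (k : ℕ) : Type := {s : Finset (Fin (k + 1)) // s.Nonempty}

namespace SimplexFace

/-- The simplex itself, as a face. -/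
def whole (k : ℕ) : SimplexFace k := ⟨Finset.univ, Finset.univ_nonempty⟩

lemma le_whole {k : ℕ} (s : SimplexFace k) : s ≤ whole k := Finset.subset_univ s.1

/-- The dimension of a face. -/
def dim {k : ℕ} (s : SimplexFace k) : ℕ := s.1.card - 1

/-- The intersection of two faces that have a common vertex, which is the case as soon as the
corresponding closed faces meet. -/
def inter {k : ℕ} (s t : SimplexFace k) (h : (s.1 ∩ t.1).Nonempty) : SimplexFace k :=
  ⟨s.1 ∩ t.1, h⟩

lemma inter_le_left {k : ℕ} (s t : SimplexFace k) (h : (s.1 ∩ t.1).Nonempty) :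
    s.inter t h ≤ s := Finset.inter_subset_left (s₁ := s.1) (s₂ := t.1)

lemma inter_le_right {k : ℕ} (s t : SimplexFace k) (h : (s.1 ∩ t.1).Nonempty) :
    s.inter t h ≤ t := Finset.inter_subset_right (s₁ := s.1) (s₂ := t.1)

end SimplexFace

variable {V : Type*} [NormedAddCommGroup V] [NormedSpace ℝ V] {k : ℕ}

namespace Affine.Simplex

/-- The closed face spanned by the vertices in `s`. -/
def faceSet (Δ : Affine.Simplex ℝ V k) (s : SimplexFace k) : Set V :=
  convexHull ℝ (Δ.points '' (s.1 : Set (Fin (k + 1))))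

/-- The direction of a face: the vector subspace of `V` parallel to it. -/
abbrev faceDir (Δ : Affine.Simplex ℝ V k) (s : SimplexFace k) : Submodule ℝ V :=
  vectorSpan ℝ (Δ.points '' (s.1 : Set (Fin (k + 1))))

/-- A vertex of the face, used as an origin. -/
def faceOrigin (Δ : Affine.Simplex ℝ V k) (s : SimplexFace k) : V :=
  Δ.points (s.1.min' s.2)

lemma faceSet_sub_mem (Δ : Affine.Simplex ℝ V k) (s : SimplexFace k) {x y : V}
    (hx : x ∈ Δ.faceSet s) (hy : y ∈ Δ.faceSet s) : x - y ∈ Δ.faceDir s := by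
  have hx' := convexHull_subset_affineSpan _ hx
  have hy' := convexHull_subset_affineSpan _ hy
  rw [faceDir, ← direction_affineSpan]
  exact AffineSubspace.vsub_mem_direction hx' hy'

lemma point_mem_faceSet (Δ : Affine.Simplex ℝ V k) (s : SimplexFace k) {i : Fin (k + 1)}
    (hi : i ∈ s.1) : Δ.points i ∈ Δ.faceSet s :=
  subset_convexHull ℝ _ (Set.mem_image_of_mem _ hi)

lemma faceOrigin_mem (Δ : Affine.Simplex ℝ V k) (s : SimplexFace k) :
    Δ.faceOrigin s ∈ Δ.faceSet s :=
  Δ.point_mem_faceSet s (Finset.min'_mem _ _)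

instance (Δ : Affine.Simplex ℝ V k) (s : SimplexFace k) :
    FiniteDimensional ℝ (Δ.faceDir s) :=
  finiteDimensional_vectorSpan_of_finite ℝ ((Finset.finite_toSet _).image _)

/-- The vertices of a face, relative to its origin. -/
def faceVertex (Δ : Affine.Simplex ℝ V k) (s : SimplexFace k) (i : s.1) : Δ.faceDir s :=
  ⟨Δ.points i - Δ.faceOrigin s,
    Δ.faceSet_sub_mem s (Δ.point_mem_faceSet s i.2) (Δ.faceOrigin_mem s)⟩

/-- The affine embedding of the direction of a face, sending `0` to the origin of the face. -/
def faceEmb (Δ : Affine.Simplex ℝ V k) (s : SimplexFace k) : Δ.faceDir s →ᵃ[ℝ] V :=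
  (Δ.faceDir s).subtype.toAffineMap + AffineMap.const ℝ _ (Δ.faceOrigin s)

lemma faceEmb_apply (Δ : Affine.Simplex ℝ V k) (s : SimplexFace k) (y : Δ.faceDir s) :
    Δ.faceEmb s y = y + Δ.faceOrigin s := rfl

lemma faceEmb_injective (Δ : Affine.Simplex ℝ V k) (s : SimplexFace k) :
    Function.Injective (Δ.faceEmb s) := fun a b h => by
  simpa [faceEmb_apply] using h

lemma faceEmb_comp_faceVertex (Δ : Affine.Simplex ℝ V k) (s : SimplexFace k) :
    Δ.faceEmb s ∘ Δ.faceVertex s = fun i : s.1 => Δ.points i := by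
  funext i
  simp [faceEmb_apply, faceVertex]

/-- The vertices of a face form an affine basis of its direction. -/
def faceBasis (Δ : Affine.Simplex ℝ V k) (s : SimplexFace k) :
    AffineBasis s.1 ℝ (Δ.faceDir s) := by
  have hind : AffineIndependent ℝ (fun i : s.1 => Δ.points i) :=
    Δ.independent.comp_embedding (Function.Embedding.subtype (· ∈ s.1))
  have hind' : AffineIndependent ℝ (Δ.faceVertex s) := by
    apply AffineIndependent.of_comp (Δ.faceEmb s)
    rw [faceEmb_comp_faceVertex]
    exact hind
  refine ⟨Δ.faceVertex s, hind', ?_⟩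
  have hpos : 0 < Fintype.card s.1 := by simpa using s.2
  rw [hind'.affineSpan_eq_top_iff_card_eq_finrank_add_one]
  have h := hind.finrank_vectorSpan (n := Fintype.card s.1 - 1) (by omega)
  have hr : Set.range (fun i : s.1 => Δ.points i)
      = Δ.points '' (s.1 : Set (Fin (k + 1))) := by
    ext x; simp
  rw [hr] at h
  rw [faceDir, h]
  omega

lemma faceEmb_mem_iff (Δ : Affine.Simplex ℝ V k) (s : SimplexFace k) (y : Δ.faceDir s) :
    Δ.faceEmb s y ∈ Δ.faceSet s ↔ y ∈ convexHull ℝ (Set.range (Δ.faceBasis s)) := by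
  have h : Δ.faceSet s = Δ.faceEmb s '' convexHull ℝ (Set.range (Δ.faceBasis s)) := by
    rw [AffineMap.image_convexHull, ← Set.range_comp]
    change _ = convexHull ℝ (Set.range (Δ.faceEmb s ∘ Δ.faceVertex s))
    rw [faceEmb_comp_faceVertex, faceSet]
    congr 1
    ext x; simp
  rw [h, (Δ.faceEmb_injective s).mem_set_image]

/-- A retraction of the direction of a face onto the (translated) face: replace the negative
barycentric coordinates by zero, and normalize. Only its restriction to the face matters. -/
def faceRetract (Δ : Affine.Simplex ℝ V k) (s : SimplexFace k) (y : Δ.faceDir s) : Δ.faceDir s :=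
  Finset.univ.centerMass (fun i => max ((Δ.faceBasis s).coord i y) 0) (Δ.faceBasis s)

lemma sum_max_coord_pos (Δ : Affine.Simplex ℝ V k) (s : SimplexFace k) (y : Δ.faceDir s) :
    0 < ∑ i, max ((Δ.faceBasis s).coord i y) 0 :=
  lt_of_lt_of_le one_pos <| by
    rw [← (Δ.faceBasis s).sum_coord_apply_eq_one y]
    exact Finset.sum_le_sum fun i _ => le_max_left _ _

lemma faceRetract_mem (Δ : Affine.Simplex ℝ V k) (s : SimplexFace k) (y : Δ.faceDir s) :
    Δ.faceRetract s y ∈ convexHull ℝ (Set.range (Δ.faceBasis s)) :=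
  Finset.centerMass_mem_convexHull _ (fun _ _ => le_max_right _ _) (Δ.sum_max_coord_pos s y)
    fun i _ => Set.mem_range_self i

lemma faceRetract_eq (Δ : Affine.Simplex ℝ V k) (s : SimplexFace k) {y : Δ.faceDir s}
    (hy : y ∈ convexHull ℝ (Set.range (Δ.faceBasis s))) : Δ.faceRetract s y = y := by
  rw [AffineBasis.convexHull_eq_nonneg_coord] at hy
  have h : (fun i => max ((Δ.faceBasis s).coord i y) 0) = fun i => (Δ.faceBasis s).coord i y :=
    funext fun i => max_eq_left (hy i)
  rw [faceRetract, h, Finset.centerMass_eq_of_sum_1 _ _ ((Δ.faceBasis s).sum_coord_apply_eq_one y)]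
  exact (Δ.faceBasis s).linear_combination_coord_eq_self y

lemma continuous_faceRetract (Δ : Affine.Simplex ℝ V k) (s : SimplexFace k) :
    Continuous (Δ.faceRetract s) := by
  have hc : ∀ i, Continuous fun y => max ((Δ.faceBasis s).coord i y) 0 := fun i =>
    (continuous_barycentric_coord (Δ.faceBasis s) i).max continuous_const
  have h0 : ∀ y, ∑ i, max ((Δ.faceBasis s).coord i y) 0 ≠ 0 := fun y =>
    (Δ.sum_max_coord_pos s y).ne'
  unfold faceRetract Finset.centerMass
  exact ((continuous_finsetSum _ fun i _ => hc i).inv₀ h0).smul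
    (continuous_finsetSum _ fun i _ => (hc i).smul continuous_const)

/-- The smooth structure of a closed face: its embedding `x ↦ x - origin` into its direction, as a
convex set with nonempty interior, makes the face a manifold with corners with a single chart. -/
def faceModel (Δ : Affine.Simplex ℝ V k) (s : SimplexFace k) :
    ModelWithCorners ℝ (Δ.faceDir s) (Δ.faceSet s) :=
  ModelWithCorners.ofConvexRange
    { toFun := fun x => ⟨x - Δ.faceOrigin s, Δ.faceSet_sub_mem s x.2 (Δ.faceOrigin_mem s)⟩
      invFun := fun y => ⟨Δ.faceEmb s (Δ.faceRetract s y),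
        (Δ.faceEmb_mem_iff s _).2 (Δ.faceRetract_mem s y)⟩
      source := Set.univ
      target := convexHull ℝ (Set.range (Δ.faceBasis s))
      map_source' := fun x _ => by
        rw [← faceEmb_mem_iff, faceEmb_apply]
        simp
      map_target' := fun _ _ => Set.mem_univ _
      left_inv' := fun x _ => by
        apply Subtype.ext
        simp only
        rw [faceRetract_eq]
        · simp [faceEmb_apply]
        · rw [← faceEmb_mem_iff, faceEmb_apply]
          simp
      right_inv' := fun y hy => by
        apply Subtype.ext
        simp [faceRetract_eq Δ s hy, faceEmb_apply] }
    rfl (convex_convexHull ℝ _)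
    (by
      change Continuous fun x : Δ.faceSet s => (⟨x - Δ.faceOrigin s, _⟩ : Δ.faceDir s)
      fun_prop)
    (Continuous.subtype_mk (continuous_induced_dom.comp (Δ.continuous_faceRetract s) |>.add
      continuous_const) _)
    (interior_convexHull_nonempty_iff_affineSpan_eq_top.2 (Δ.faceBasis s).tot)

lemma faceSet_mono (Δ : Affine.Simplex ℝ V k) {s t : SimplexFace k} (h : t ≤ s) :
    Δ.faceSet t ⊆ Δ.faceSet s :=
  convexHull_mono (Set.image_mono (Finset.coe_subset.2 h))

/-- The inclusion of a face into a larger face. -/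
abbrev faceIncl (Δ : Affine.Simplex ℝ V k) {s t : SimplexFace k} (h : t ≤ s) :
    Δ.faceSet t → Δ.faceSet s :=
  fun x => ⟨x, Δ.faceSet_mono h x.2⟩

lemma contMDiff_faceIncl (Δ : Affine.Simplex ℝ V k) {s t : SimplexFace k} (h : t ≤ s) :
    ContMDiff (Δ.faceModel t) (Δ.faceModel s) ∞ (Δ.faceIncl h) := by
  have hdir : Δ.faceDir t ≤ Δ.faceDir s :=
    vectorSpan_mono ℝ (Set.image_mono (Finset.coe_subset.2 h))
  have hmem : Δ.faceOrigin t - Δ.faceOrigin s ∈ Δ.faceDir s :=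
    Δ.faceSet_sub_mem s (Δ.faceIncl h ⟨_, Δ.faceOrigin_mem t⟩).2 (Δ.faceOrigin_mem s)
  rw [contMDiff_iff]
  refine ⟨by fun_prop, fun x y => ?_⟩
  have hsm : ContDiff ℝ ∞ fun z : Δ.faceDir t =>
      (Submodule.inclusion hdir).toContinuousLinearMap z +
        (⟨Δ.faceOrigin t - Δ.faceOrigin s, hmem⟩ : Δ.faceDir s) := by fun_prop
  refine hsm.contDiffOn.congr fun z hz => ?_
  obtain ⟨w, rfl⟩ : ∃ w, Δ.faceModel t w = z := by
    have := hz.1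
    simp only [extChartAt, mfld_simps] at this
    exact this.1
  have hw : (extChartAt (Δ.faceModel t) x).symm (Δ.faceModel t w) = w :=
    (Δ.faceModel t).left_inv w
  simp only [Function.comp_apply, hw]
  apply Subtype.ext
  change (w : V) - Δ.faceOrigin s =
    ((w : V) - Δ.faceOrigin t) + (Δ.faceOrigin t - Δ.faceOrigin s)
  abel

end Affine.Simplex

end Simplices

/-! ### Piecewise smooth forms on a simplex -/

section PiecewiseSmooth

variable {V : Type*} [NormedAddCommGroup V] [NormedSpace ℝ V] {k : ℕ}
  {Δ : Affine.Simplex ℝ V k}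
  {F : Type*} [NormedAddCommGroup F] [NormedSpace ℝ F]
  {A : Δ.faceSet (SimplexFace.whole k) → Type*} [TopologicalSpace (TotalSpace F A)]
  [∀ x, AddCommGroup (A x)] [∀ x, Module ℝ (A x)] [∀ x, TopologicalSpace (A x)]
  [FiberBundle F A] [VectorBundle ℝ F A]
  [ContMDiffVectorBundle ∞ F A (Δ.faceModel (SimplexFace.whole k))]

namespace LieAlgebroid

/-- The fibre at `x` of the restriction of a Lie algebroid on the simplex to the face `s`. -/
abbrev faceFibre (L : LieAlgebroid (Δ.faceModel (SimplexFace.whole k)) F A)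
    (s : SimplexFace k) (x : Δ.faceSet s) : Submodule ℝ (A (Δ.faceIncl s.le_whole x)) :=
  L.restrictFibre (Δ.faceModel s) (Δ.faceIncl s.le_whole) x

/-- The smooth `p`-forms on the restriction of a Lie algebroid on the simplex to the face `s`. -/
abbrev FaceForm (L : LieAlgebroid (Δ.faceModel (SimplexFace.whole k)) F A)
    (s : SimplexFace k) (p : ℕ) :=
  L.SmoothForm (Δ.faceModel s) (Δ.faceIncl s.le_whole) p

/-- The fibres of the restriction to a smaller face are subspaces of those of the restriction to a
larger one. -/
lemma faceFibre_le (L : LieAlgebroid (Δ.faceModel (SimplexFace.whole k)) F A)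
    {s t : SimplexFace k} (h : t ≤ s) (x : Δ.faceSet t) :
    L.faceFibre t x ≤ L.faceFibre s (Δ.faceIncl h x) := by
  rintro a ⟨u, hu⟩
  refine ⟨mfderiv (Δ.faceModel t) (Δ.faceModel s) (Δ.faceIncl h) x u, ?_⟩
  refine Eq.trans ?_ hu
  have hc := mfderiv_comp x
    ((Δ.contMDiff_faceIncl s.le_whole).mdifferentiable (by simp) (Δ.faceIncl h x))
    ((Δ.contMDiff_faceIncl h).mdifferentiable (by simp) x)
  exact (congrArg (fun T => T u) hc).symm

/-- The restriction of a form from a face `s` to a face `t` of `s`, at the points of `t`. -/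
def FaceForm.restrict {L : LieAlgebroid (Δ.faceModel (SimplexFace.whole k)) F A}
    {s t : SimplexFace k} {p : ℕ} (η : L.FaceForm s p) (h : t ≤ s) (x : Δ.faceSet t) :
    (L.faceFibre t x) [⋀^Fin p]→ₗ[ℝ] ℝ :=
  (η.toFun (Δ.faceIncl h x)).compLinearMap (Submodule.inclusion (L.faceFibre_le h x))

/-- Piecewise smooth forms of degree `p` on the complex of Lie algebroids formed by the
restrictions of a Lie algebroid on the simplex to all the faces: families of smooth forms, one on
each face, compatible with the restrictions to smaller faces. -/
structure PiecewiseSmoothForm (L : LieAlgebroid (Δ.faceModel (SimplexFace.whole k)) F A)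
    (p : ℕ) where
  form : ∀ s : SimplexFace k, L.FaceForm s p
  compat : ∀ (s t : SimplexFace k) (h : t ≤ s) (x : Δ.faceSet t),
    FaceForm.restrict (form s) h x = (form t).toFun x

end LieAlgebroid

end PiecewiseSmooth

end

/-! It suffices to find one smooth family `η` of alternating forms on the full fibres of `A` whose
restriction to each face in `J` is the given form: its restrictions to all faces are then
automatically compatible. A combination of such families with weights of sum one restricts again to
the given forms, so a partition of unity reduces the problem to a neighbourhood of a point `x₀`.

Some barycentric coordinate of `x₀`, say that of the vertex `j`, is nonzero, so near `x₀` only faces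
containing `j` matter. These are treated one at a time. Suppose that `η` is already right on the
faces in `T`, and let `s` be the new face, opposite to `i ≠ j`. The affine map moving `i` to `j` and
fixing the other vertices gives a retraction `r` onto `s`, which sends every face `t` containing `j`
into `s ∩ t` (`exists_retraction`). Transitivity gives, near `x₀`, linear maps from `A` at `x` to
the restriction of `A` to `s` at `r x`. They cover the linear part `R` of the retraction and are the
identity on the restriction of `A` to `s` at the points of `s` (`exists_transport_frame`). Add to
`η` the pullback of the defect `ξ s - η|s` along these maps. On `s` the result is `ξ s`. On a face
`t` in `T` nothing changes: vectors tangent to `t` are sent to vectors tangent to `s ∩ t`, where the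
defect vanishes because `η|t = ξ t` agrees there with `ξ s`.

Smoothness of `η` is tested along smooth maps from faces (`SmoothFamilyAt`), a condition that passes
both to restrictions and to pullbacks by `r`. -/

/-! ### Splitting the anchor and transporting fibres. -/

section TransportFrame

variable {E₀ : Type*} [NormedAddCommGroup E₀] [NormedSpace ℝ E₀]
  {H : Type*} [TopologicalSpace H] {I : ModelWithCorners ℝ E₀ H}
  {M : Type*} [TopologicalSpace M] [ChartedSpace H M]
  {F : Type*} [NormedAddCommGroup F] [NormedSpace ℝ F]
  {A : M → Type*} [TopologicalSpace (TotalSpace F A)]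
  [∀ x, AddCommGroup (A x)] [∀ x, Module ℝ (A x)] [∀ x, TopologicalSpace (A x)]
  [FiberBundle F A] [VectorBundle ℝ F A]
  {E : Type*} [NormedAddCommGroup E] [NormedSpace ℝ E] [FiniteDimensional ℝ E]

/-- Sections that are constant in a trivialization are smooth. -/
lemma contMDiffOn_trivialization_symm [ContMDiffVectorBundle ∞ F A I]
    (e : Trivialization F (TotalSpace.proj : TotalSpace F A → M)) [MemTrivializationAtlas e]
    (v : F) :
    ContMDiffOn I (I.prod 𝓘(ℝ, F)) ∞ (fun x => (⟨x, e.symm x v⟩ : TotalSpace F A)) e.baseSet := by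
  rw [e.contMDiffOn_section_baseSet_iff]
  refine (contMDiffOn_const (c := v)).congr fun x hx => ?_
  rw [e.apply_mk_symm hx]

/-- A smooth morphism of vector bundles into a trivial bundle that is surjective at a point has
a smooth right inverse near that point. -/
lemma exists_smooth_rightInverse [ContMDiffVectorBundle ∞ F A I] (Γ : ∀ x, A x →ₗ[ℝ] E)
    (hΓ : ContMDiff (I.prod 𝓘(ℝ, F)) 𝓘(ℝ, E) ∞ (fun a : TotalSpace F A => Γ a.1 a.2))
    (x₀ : M) (hx₀ : Function.Surjective (Γ x₀)) :
    ∃ W : Set M, IsOpen W ∧ x₀ ∈ W ∧ ∃ S : ∀ x, E →ₗ[ℝ] A x,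
      (∀ x ∈ W, ∀ u, Γ x (S x u) = u) ∧
      ∀ (u : M → E) (U : Set M), U ⊆ W → ContMDiffOn I 𝓘(ℝ, E) ∞ u U →
        ContMDiffOn I (I.prod 𝓘(ℝ, F)) ∞ (fun x => (⟨x, S x (u x)⟩ : TotalSpace F A)) U := by
  let e := trivializationAt F A x₀
  have hxe : x₀ ∈ e.baseSet := mem_baseSet_trivializationAt F A x₀
  let w := Module.finBasis ℝ E
  let cw : Fin (Module.finrank ℝ E) → E →L[ℝ] ℝ := fun n =>
    LinearMap.toContinuousLinearMap (w.coord n)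
  -- Lifts of a basis of `E` to the fibre at `x₀`, extended to sections constant in the
  -- trivialization.
  choose a ha using fun n => hx₀ (w n)
  let s : Fin (Module.finrank ℝ E) → ∀ x, A x := fun n x => e.symm x (e ⟨x₀, a n⟩).2
  have hs : ∀ n, ContMDiffOn I (I.prod 𝓘(ℝ, F)) ∞ (fun x => (⟨x, s n x⟩ : TotalSpace F A))
      e.baseSet := fun n => contMDiffOn_trivialization_symm e _
  -- `N x` sends `w n` to `Γ x (s n x)`. It is the identity at `x₀`, hence invertible nearby, and
  -- the right inverse is `N x`⁻¹ followed by `w n ↦ s n x`.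
  let N : M → E →L[ℝ] E := fun x => ∑ n, (cw n).smulRight (Γ x (s n x))
  have hN : ContMDiffOn I 𝓘(ℝ, E →L[ℝ] E) ∞ N e.baseSet := by
    refine contMDiffOn_finsetSum fun n _ => ?_
    have h1 : ContMDiffOn I 𝓘(ℝ, E) ∞ (fun x => Γ x (s n x)) e.baseSet :=
      hΓ.comp_contMDiffOn (hs n)
    exact ((ContinuousLinearMap.smulRightL ℝ E E (cw n)).contMDiff).comp_contMDiffOn h1
  have hN₀ : N x₀ = 1 := by
    ext u
    have : ∀ n, s n x₀ = a n := fun n => by simp [s, e.symm_apply_apply_mk hxe]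
    simp only [N, this, ha]
    simp [cw, w.sum_repr u]
  let W := e.baseSet ∩ N ⁻¹' {T | IsUnit T}
  have hWo : IsOpen W := hN.continuousOn.isOpen_inter_preimage e.open_baseSet Units.isOpen
  have hinv : ContMDiffOn I 𝓘(ℝ, E →L[ℝ] E) ∞ (fun x => Ring.inverse (N x)) W := by
    intro x hx
    obtain ⟨T, hT⟩ := hx.2
    have := (contDiffAt_ringInverse ℝ (n := ∞) T).contMDiffAt
    rw [hT] at this
    exact this.comp_contMDiffWithinAt x ((hN x hx.1).mono inter_subset_left)
  refine ⟨W, hWo, ⟨hxe, by simp [hN₀]⟩,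
    fun x => ∑ n, ((cw n).toLinearMap ∘ₗ (Ring.inverse (N x)).toLinearMap).smulRight (s n x),
    fun x hx u => ?_, fun u U hU hu => ?_⟩
  · have h1 : N x (Ring.inverse (N x) u) = u :=
      congrArg (fun T : E →L[ℝ] E => T u) (Ring.mul_inverse_cancel (N x) hx.2)
    conv_rhs => rw [← h1]
    simp [N]
  · have : ∀ x, (∑ n, ((cw n).toLinearMap ∘ₗ (Ring.inverse (N x)).toLinearMap).smulRight (s n x))
        (u x) = ∑ n, cw n (Ring.inverse (N x) (u x)) • s n x := fun x => by simp
    simp only [this]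
    refine ContMDiffOn.sum_section fun n _ => ?_
    refine ContMDiffOn.smul_section ?_ ((hs n).mono (hU.trans inter_subset_left))
    exact (cw n).contMDiff.comp_contMDiffOn ((hinv.mono hU).clm_apply hu)

/-- Near a point at which a smooth morphism `Γ : A → E` is surjective there is a smooth family of
linear maps `A x → A z` of finite rank that cover a given projection `R` of `E` to a subspace `K`,
and are the identity on `Γ⁻¹(K)` for `x = z`. -/
lemma exists_transport_frame [FiniteDimensional ℝ F] [ContMDiffVectorBundle ∞ F A I]
    (Γ : ∀ x, A x →ₗ[ℝ] E)
    (hΓ : ContMDiff (I.prod 𝓘(ℝ, F)) 𝓘(ℝ, E) ∞ (fun a : TotalSpace F A => Γ a.1 a.2))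
    (x₀ : M) (hx₀ : Function.Surjective (Γ x₀)) (K : Submodule ℝ E) (R : E →ₗ[ℝ] E)
    (hRK : ∀ u, R u ∈ K) (hR : ∀ u ∈ K, R u = u) :
    ∃ W : Set M, IsOpen W ∧ x₀ ∈ W ∧ ∃ (C : Type) (_ : Fintype C) (θ : C → ∀ x, A x →ₗ[ℝ] ℝ)
      (σ : C → ∀ x, A x),
      (∀ c, ContMDiffOn (I.prod 𝓘(ℝ, F)) 𝓘(ℝ, ℝ) ∞ (fun a : TotalSpace F A => θ c a.1 a.2)
        (TotalSpace.proj ⁻¹' W)) ∧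
      (∀ c, ContMDiffOn I (I.prod 𝓘(ℝ, F)) ∞ (fun x => (⟨x, σ c x⟩ : TotalSpace F A)) W) ∧
      (∀ c x, Γ x (σ c x) ∈ K) ∧
      (∀ x ∈ W, ∀ z ∈ W, ∀ a, Γ z (∑ c, θ c x a • σ c z) = R (Γ x a)) ∧
      (∀ x ∈ W, ∀ a, Γ x a ∈ K → ∑ c, θ c x a • σ c x = a) := by
  classical
  obtain ⟨W₁, hW₁, hx₁, S, hS, hSs⟩ := exists_smooth_rightInverse Γ hΓ x₀ hx₀
  let e := trivializationAt F A x₀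
  have hxe : x₀ ∈ e.baseSet := mem_baseSet_trivializationAt F A x₀
  let b := Module.finBasis ℝ F
  let w := Module.finBasis ℝ K
  let R' : E →ₗ[ℝ] K := R.codRestrict K hRK
  let W := W₁ ∩ e.baseSet
  -- The first block carries `a` from `x` to `z` through the trivialization and projects it to the
  -- kernel of `Γ z` along the image of `S z`; the second adds the lift `S z (R (Γ x a))`. If `x =
  -- z` and `Γ x a ∈ K`, the two add up to `a`.
  let θ : Fin (Module.finrank ℝ F) ⊕ Fin (Module.finrank ℝ K) → ∀ x, A x →ₗ[ℝ] ℝ := fun c x =>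
    c.elim (fun m => b.coord m ∘ₗ e.linearMapAt ℝ x) (fun n => w.coord n ∘ₗ R' ∘ₗ Γ x)
  let τ : Fin (Module.finrank ℝ F) ⊕ Fin (Module.finrank ℝ K) → ∀ x, A x := fun c x =>
    c.elim (fun m => e.symm x (b m) - S x (Γ x (e.symm x (b m)))) (fun n => S x (w n))
  -- The value zero outside `W` makes `Γ x (σ c x) ∈ K` hold at every point, so that `σ` will define
  -- global sections of the restriction to a face.
  let σ : Fin (Module.finrank ℝ F) ⊕ Fin (Module.finrank ℝ K) → ∀ x, A x := fun c x =>
    if x ∈ W then τ c x else 0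
  have hsum : ∀ x ∈ W, ∀ z ∈ W, ∀ a, ∑ c, θ c x a • σ c z =
      (e.symmₗ ℝ z (e.linearMapAt ℝ x a) - S z (Γ z (e.symmₗ ℝ z (e.linearMapAt ℝ x a)))) +
        S z (R (Γ x a)) := by
    intro x hx z hz a
    rw [Fintype.sum_sum_type]
    congr 1
    · conv_rhs => rw [← b.sum_repr (e.linearMapAt ℝ x a)]
      simp only [map_sum, map_smul, ← Finset.sum_sub_distrib, ← smul_sub]
      simp only [e.coe_symmₗ (R := ℝ) hz.2, θ, σ, τ, hz, if_true, Sum.elim_inl, LinearMap.comp_apply,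
        Module.Basis.coord_apply]
    · have h1 : R (Γ x a) = ∑ n, w.repr (R' (Γ x a)) n • (w n : E) := by
        have := congrArg Subtype.val (w.sum_repr (R' (Γ x a)))
        rw [Submodule.coe_sum] at this
        exact this.symm
      rw [h1]
      simp only [map_sum, map_smul]
      simp [θ, σ, τ, hz]
  refine ⟨W, hW₁.inter e.open_baseSet, ⟨hx₁, hxe⟩, _, inferInstance, θ, σ, ?_, ?_, ?_, ?_, ?_⟩
  · rintro (m | n)
    · have h1 : ContMDiffOn (I.prod 𝓘(ℝ, F)) 𝓘(ℝ, F) ∞ (fun a : TotalSpace F A => (e a).2)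
          (TotalSpace.proj ⁻¹' W) := by
        exact (contMDiff_snd.comp_contMDiffOn (e.contMDiffOn (IB := I) (n := ∞))).mono
          fun a ha => e.mem_source.2 ha.2
      refine ((LinearMap.toContinuousLinearMap (b.coord m)).contMDiff.comp_contMDiffOn h1).congr
        fun a ha => ?_
      simp [θ, show a.proj ∈ e.baseSet from ha.2]
    · exact ((LinearMap.toContinuousLinearMap (w.coord n ∘ₗ R')).contMDiff.comp hΓ).contMDiffOn
  · have key : ∀ c, ContMDiffOn I (I.prod 𝓘(ℝ, F)) ∞ (fun x => (⟨x, τ c x⟩ : TotalSpace F A)) W := by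
      rintro (m | n)
      · have h1 := contMDiffOn_trivialization_symm (I := I) e (b m)
        exact (h1.mono inter_subset_right).sub_section
          (hSs _ _ inter_subset_left (hΓ.comp_contMDiffOn (h1.mono inter_subset_right)))
      · exact hSs (fun _ => (w n : E)) _ inter_subset_left contMDiffOn_const
    intro c
    refine (key c).congr fun x hx => ?_
    simp [σ, hx]
  · intro c x
    by_cases hx : x ∈ W
    · simp only [σ, hx, if_true]
      rcases c with m | n
      · simp [τ, hS x hx.1]
      · simp [τ, hS x hx.1]
    · simp [σ, hx]
  · intro x hx z hz a
    rw [hsum x hx z hz]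
    simp [hS z hz.1]
  · intro x hx a ha
    rw [hsum x hx x hx, hR _ ha]
    simp [e.symmₗ_linearMapAt hx.2]

end TransportFrame

/-! ### Affine maps between faces, barycentric coordinates and retractions. -/

section FaceMaps

variable {V : Type*} [NormedAddCommGroup V] [NormedSpace ℝ V] {k : ℕ}

namespace Affine.Simplex

lemma faceModel_coe (Δ : Affine.Simplex ℝ V k) (s : SimplexFace k) (x : Δ.faceSet s) :
    (Δ.faceModel s x : V) = x - Δ.faceOrigin s := rfl

/-- The chart of a face is a translation, so an affine map with linear part `T` reads in charts as
`T` plus a constant. This holds only on the range of the model, where the inverse chart really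
inverts it. -/
lemma affine_writtenInExtChartAt (Δ : Affine.Simplex ℝ V k) {s t : SimplexFace k}
    (f : Δ.faceSet t → Δ.faceSet s) (T : Δ.faceDir t →L[ℝ] Δ.faceDir s)
    (hf : ∀ x y : Δ.faceSet t,
      Δ.faceModel s (f x) - Δ.faceModel s (f y) = T (Δ.faceModel t x - Δ.faceModel t y))
    (x : Δ.faceSet t) :
    Set.EqOn (Δ.faceModel s ∘ f ∘ (Δ.faceModel t).symm)
      (fun z => T z + (Δ.faceModel s (f x) - T (Δ.faceModel t x))) (range (Δ.faceModel t)) := by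
  rintro _ ⟨w, rfl⟩
  have hw : (Δ.faceModel t).symm (Δ.faceModel t w) = w := (Δ.faceModel t).left_inv w
  have := hf w x
  rw [map_sub] at this
  simp only [Function.comp_apply, hw]
  rw [← sub_eq_zero] at this ⊢
  rw [← this]
  abel

lemma continuous_of_affine (Δ : Affine.Simplex ℝ V k) {s t : SimplexFace k}
    (f : Δ.faceSet t → Δ.faceSet s) (T : Δ.faceDir t →L[ℝ] Δ.faceDir s)
    (hf : ∀ x y : Δ.faceSet t,
      Δ.faceModel s (f x) - Δ.faceModel s (f y) = T (Δ.faceModel t x - Δ.faceModel t y)) :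
    Continuous f := by
  have h : f = (Δ.faceModel s).symm ∘
      (fun x => T (Δ.faceModel t x - Δ.faceModel t ⟨_, Δ.faceOrigin_mem t⟩) +
        Δ.faceModel s (f ⟨_, Δ.faceOrigin_mem t⟩)) := by
    funext x
    simp only [Function.comp_apply, ← hf, sub_add_cancel]
    exact ((Δ.faceModel s).left_inv _).symm
  rw [h]
  exact (Δ.faceModel s).continuous_symm.comp
    ((T.continuous.comp ((Δ.faceModel t).continuous.sub continuous_const)).add continuous_const)

lemma contMDiff_of_affine (Δ : Affine.Simplex ℝ V k) {s t : SimplexFace k}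
    (f : Δ.faceSet t → Δ.faceSet s) (T : Δ.faceDir t →L[ℝ] Δ.faceDir s)
    (hf : ∀ x y : Δ.faceSet t,
      Δ.faceModel s (f x) - Δ.faceModel s (f y) = T (Δ.faceModel t x - Δ.faceModel t y)) :
    ContMDiff (Δ.faceModel t) (Δ.faceModel s) ∞ f := by
  rw [contMDiff_iff]
  refine ⟨Δ.continuous_of_affine f T hf, fun x y => ?_⟩
  have hsm : ContDiff ℝ ∞ fun z : Δ.faceDir t =>
      T z + (Δ.faceModel s (f x) - T (Δ.faceModel t x)) := by fun_prop
  refine hsm.contDiffOn.congr fun z hz => Δ.affine_writtenInExtChartAt f T hf x ?_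
  have := hz.1
  simp only [extChartAt, mfld_simps] at this
  exact this.1

lemma mfderiv_of_affine (Δ : Affine.Simplex ℝ V k) {s t : SimplexFace k}
    (f : Δ.faceSet t → Δ.faceSet s) (T : Δ.faceDir t →L[ℝ] Δ.faceDir s)
    (hf : ∀ x y : Δ.faceSet t,
      Δ.faceModel s (f x) - Δ.faceModel s (f y) = T (Δ.faceModel t x - Δ.faceModel t y))
    (x : Δ.faceSet t) (u : Δ.faceDir t) :
    mfderiv (Δ.faceModel t) (Δ.faceModel s) f x u = T u := by
  have h : HasMFDerivAt (Δ.faceModel t) (Δ.faceModel s) f x T := by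
    refine ⟨(Δ.continuous_of_affine f T hf).continuousAt, ?_⟩
    have h1 : HasFDerivWithinAt (fun z => T z + (Δ.faceModel s (f x) - T (Δ.faceModel t x))) T
        (range (Δ.faceModel t)) (extChartAt (Δ.faceModel t) x x) :=
      (T.hasFDerivAt.add_const _).hasFDerivWithinAt
    refine h1.congr (fun z hz => ?_) ?_
    · exact Δ.affine_writtenInExtChartAt f T hf x hz
    · exact Δ.affine_writtenInExtChartAt f T hf x ⟨x, rfl⟩
  exact congrArg (fun T' : Δ.faceDir t →L[ℝ] Δ.faceDir s => T' u) h.mfderiv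

lemma faceDir_mono (Δ : Affine.Simplex ℝ V k) {s t : SimplexFace k} (h : t ≤ s) :
    Δ.faceDir t ≤ Δ.faceDir s :=
  vectorSpan_mono ℝ (Set.image_mono (Finset.coe_subset.2 h))

lemma mfderiv_faceIncl (Δ : Affine.Simplex ℝ V k) {s t : SimplexFace k} (h : t ≤ s)
    (x : Δ.faceSet t) (u : Δ.faceDir t) :
    mfderiv (Δ.faceModel t) (Δ.faceModel s) (Δ.faceIncl h) x u =
      Submodule.inclusion (Δ.faceDir_mono h) u := by
  refine Δ.mfderiv_of_affine _ (Submodule.inclusion (Δ.faceDir_mono h)).toContinuousLinearMap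
    (fun x y => Subtype.ext ?_) x u
  change (x : V) - _ - (y - _) = (x : V) - _ - (y - _)
  abel

/-- The barycentric coordinate with respect to a vertex, extended to the ambient space. -/
lemma exists_coord (Δ : Affine.Simplex ℝ V k) (i : Fin (k + 1)) :
    ∃ c : V →ᵃ[ℝ] ℝ, ∀ m, c (Δ.points m) = if m = i then 1 else 0 := by
  have hli := (affineIndependent_iff_linearIndependent_vsub ℝ Δ.points i).1 Δ.independent
  -- `f` is a linear form equal to `1` on every edge vector issuing from vertex `i`; the coordinate
  -- is `1 - f (· - Δ.points i)`.
  obtain ⟨f, hf⟩ := LinearMap.exists_extend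
    ((Module.Basis.span hli).constr ℝ fun _ => (1 : ℝ))
  have hf' : ∀ m, m ≠ i → f (Δ.points m - Δ.points i) = 1 := fun m hm => by
    have h := (Module.Basis.span hli).constr_basis ℝ (fun _ => (1 : ℝ)) ⟨m, hm⟩
    rw [← hf] at h
    simpa [Module.Basis.span_apply] using h
  refine ⟨AffineMap.const ℝ V 1 - f.toAffineMap.comp
    (AffineMap.id ℝ V - AffineMap.const ℝ V (Δ.points i)), fun m => ?_⟩
  rcases eq_or_ne m i with rfl | hm
  · simp
  · have := hf' m hm
    rw [map_sub] at this
    simp [hm, this]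

lemma coord_eq_zero (Δ : Affine.Simplex ℝ V k) {i : Fin (k + 1)} {c : V →ᵃ[ℝ] ℝ}
    (hc : ∀ m, c (Δ.points m) = if m = i then 1 else 0) {s : SimplexFace k} (hi : i ∉ s.1)
    {x : V} (hx : x ∈ Δ.faceSet s) : c x = 0 := by
  have h : c '' Δ.faceSet s ⊆ {0} := by
    rw [faceSet, AffineMap.image_convexHull]
    refine convexHull_min ?_ (convex_singleton 0)
    rintro _ ⟨_, ⟨m, hm, rfl⟩, rfl⟩
    rw [hc, if_neg (by rintro rfl; exact hi hm)]
    rfl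
  exact h ⟨x, hx, rfl⟩

/-- No point of the simplex belongs to all the faces opposite to the vertices. -/
lemma exists_forall_notMem_faceSet (Δ : Affine.Simplex ℝ V k) {x : V}
    (hx : x ∈ Δ.faceSet (SimplexFace.whole k)) :
    ∃ j, ∀ s : SimplexFace k, j ∉ s.1 → x ∉ Δ.faceSet s := by
  choose c hc using Δ.exists_coord
  by_contra! h
  have h0 : ∀ j, c j x = 0 := fun j => by
    obtain ⟨s, hs, hxs⟩ := h j
    exact Δ.coord_eq_zero (hc j) hs hxs
  have hsum : ∀ y, (∑ j, c j : V →ᵃ[ℝ] ℝ) y = ∑ j, c j y := fun y =>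
    map_sum (⟨⟨fun f => f y, rfl⟩, fun _ _ => rfl⟩ : (V →ᵃ[ℝ] ℝ) →+ ℝ) c Finset.univ
  -- The sum of the coordinates is affine and equals `1` at the vertices, hence on the whole
  -- simplex; it cannot vanish at `x`.
  have h1 : (∑ j, c j : V →ᵃ[ℝ] ℝ) '' Δ.faceSet (SimplexFace.whole k) ⊆ {1} := by
    rw [faceSet, AffineMap.image_convexHull]
    refine convexHull_min ?_ (convex_singleton 1)
    rintro _ ⟨_, ⟨m, hm, rfl⟩, rfl⟩
    simp [hc, hsum]
  have h2 := h1 ⟨x, hx, rfl⟩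
  simp [h0, hsum] at h2

/-- The affine map that sends a vertex `i` to a vertex `j` and fixes the others. -/
lemma exists_collapse (Δ : Affine.Simplex ℝ V k) (i j : Fin (k + 1)) :
    ∃ ρ : V →ᵃ[ℝ] V, ∀ m, ρ (Δ.points m) = Δ.points (if m = i then j else m) := by
  obtain ⟨c, hc⟩ := Δ.exists_coord i
  -- The map is `x ↦ x + c x • (Δ.points j - Δ.points i)`.
  refine ⟨AffineMap.id ℝ V + (AffineMap.lineMap 0 (Δ.points j - Δ.points i)).comp c, fun m => ?_⟩
  rcases eq_or_ne m i with rfl | hm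
  · simp [hc]
  · simp [hc, hm]

lemma affineMap_mem_faceSet (Δ : Affine.Simplex ℝ V k) {ρ : V →ᵃ[ℝ] V}
    {f : Fin (k + 1) → Fin (k + 1)} (hρ : ∀ m, ρ (Δ.points m) = Δ.points (f m))
    {s t : SimplexFace k} (hf : ∀ m ∈ t.1, f m ∈ s.1) {x : V} (hx : x ∈ Δ.faceSet t) :
    ρ x ∈ Δ.faceSet s := by
  have h : ρ '' Δ.faceSet t ⊆ Δ.faceSet s := by
    rw [faceSet, AffineMap.image_convexHull]
    refine convexHull_mono ?_
    rintro _ ⟨_, ⟨m, hm, rfl⟩, rfl⟩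
    exact ⟨f m, hf m hm, (hρ m).symm⟩
  exact h ⟨x, hx, rfl⟩

lemma linear_mem_faceDir (Δ : Affine.Simplex ℝ V k) {ρ : V →ᵃ[ℝ] V}
    {f : Fin (k + 1) → Fin (k + 1)} (hρ : ∀ m, ρ (Δ.points m) = Δ.points (f m))
    {s t : SimplexFace k} (hf : ∀ m ∈ t.1, f m ∈ s.1) {u : V} (hu : u ∈ Δ.faceDir t) :
    ρ.linear u ∈ Δ.faceDir s := by
  have h : (Δ.faceDir t).map ρ.linear ≤ Δ.faceDir s := by
    rw [faceDir, AffineMap.map_vectorSpan]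
    refine vectorSpan_mono ℝ ?_
    rintro _ ⟨_, ⟨m, hm, rfl⟩, rfl⟩
    exact ⟨f m, hf m hm, (hρ m).symm⟩
  exact h ⟨u, hu, rfl⟩

lemma affineMap_eq_self (Δ : Affine.Simplex ℝ V k) {ρ : V →ᵃ[ℝ] V} {s : SimplexFace k}
    (hρ : ∀ m ∈ s.1, ρ (Δ.points m) = Δ.points m) {x : V} (hx : x ∈ Δ.faceSet s) :
    ρ x = x := by
  have h : (ρ - AffineMap.id ℝ V) '' Δ.faceSet s ⊆ {0} := by
    rw [faceSet, AffineMap.image_convexHull]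
    refine convexHull_min ?_ (convex_singleton 0)
    rintro _ ⟨_, ⟨m, hm, rfl⟩, rfl⟩
    simp [hρ m hm]
  exact sub_eq_zero.1 (h ⟨x, hx, rfl⟩)

lemma linear_eq_self (Δ : Affine.Simplex ℝ V k) {ρ : V →ᵃ[ℝ] V} {s : SimplexFace k}
    (hρ : ∀ m ∈ s.1, ρ (Δ.points m) = Δ.points m) {u : V} (hu : u ∈ Δ.faceDir s) :
    ρ.linear u = u := by
  have h : Δ.faceDir s ≤ LinearMap.eqLocus ρ.linear LinearMap.id := by
    refine Submodule.span_le.2 ?_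
    rintro _ ⟨_, ⟨m, hm, rfl⟩, _, ⟨n, hn, rfl⟩, rfl⟩
    change ρ.linear (Δ.points m -ᵥ Δ.points n) = Δ.points m -ᵥ Δ.points n
    rw [AffineMap.linearMap_vsub, hρ m hm, hρ n hn]
  exact h hu

/-- The retraction of the simplex onto the face opposite to a vertex `i` that moves `i` to another
vertex `j` preserves all the faces that contain `j`. -/
lemma exists_retraction (Δ : Affine.Simplex ℝ V k) {i j : Fin (k + 1)} (hij : j ≠ i)
    {s : SimplexFace k} (hs : ∀ m, m ∈ s.1 ↔ m ≠ i) :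
    ∃ (r : Δ.faceSet (SimplexFace.whole k) → Δ.faceSet s)
      (R : Δ.faceDir (SimplexFace.whole k) →ₗ[ℝ] Δ.faceDir (SimplexFace.whole k)),
      ContMDiff (Δ.faceModel (SimplexFace.whole k)) (Δ.faceModel s) ∞ r ∧
      (∀ u, (R u : V) ∈ Δ.faceDir s) ∧ 
      (∀ u : Δ.faceDir (SimplexFace.whole k), (u : V) ∈ Δ.faceDir s → R u = u) ∧
      (∀ y : Δ.faceSet s, r (Δ.faceIncl s.le_whole y) = y) ∧
      ∀ (t : SimplexFace k) (h : (s.1 ∩ t.1).Nonempty), j ∈ t.1 →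
        (∀ x : Δ.faceSet (SimplexFace.whole k), (x : V) ∈ Δ.faceSet t →
          (r x : V) ∈ Δ.faceSet (s.inter t h)) ∧
        ∀ u : Δ.faceDir (SimplexFace.whole k), (u : V) ∈ Δ.faceDir t →
          (R u : V) ∈ Δ.faceDir (s.inter t h) := by
  obtain ⟨ρ, hρ⟩ := Δ.exists_collapse i j
  have hs₁ : ∀ m ∈ (SimplexFace.whole k).1, (if m = i then j else m) ∈ s.1 := fun m _ => by
    rw [hs]; split_ifs with h
    exacts [hij, h]
  have hs₂ : ∀ m ∈ s.1, ρ (Δ.points m) = Δ.points m := fun m hm => by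
    rw [hρ, if_neg ((hs m).1 hm)]
  -- Here `j ∈ t` is essential: the only vertex that moves goes to `j`, so no vertex of `t` leaves
  -- `t`.
  have ht : ∀ t (h : (s.1 ∩ t.1).Nonempty), j ∈ t.1 →
      ∀ m ∈ t.1, (if m = i then j else m) ∈ (s.inter t h).1 := fun t h hj m hm => by
    refine Finset.mem_inter.2 ⟨hs₁ m (Finset.mem_univ m), ?_⟩
    split_ifs
    exacts [hj, hm]
  let r : Δ.faceSet (SimplexFace.whole k) → Δ.faceSet s := fun x =>
    ⟨ρ x, Δ.affineMap_mem_faceSet hρ hs₁ x.2⟩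
  let R₀ : Δ.faceDir (SimplexFace.whole k) →ₗ[ℝ] Δ.faceDir s :=
    ρ.linear.restrict fun u hu => Δ.linear_mem_faceDir hρ hs₁ hu
  refine ⟨r, Submodule.inclusion (Δ.faceDir_mono s.le_whole) ∘ₗ R₀,
    Δ.contMDiff_of_affine r R₀.toContinuousLinearMap fun x y => Subtype.ext ?_,
    fun u => (R₀ u).2, fun u hu => Subtype.ext (Δ.linear_eq_self hs₂ hu),
    fun y => Subtype.ext (Δ.affineMap_eq_self hs₂ y.2), fun t h hj =>
      ⟨fun x hx => Δ.affineMap_mem_faceSet hρ (ht t h hj) hx,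
        fun u hu => Δ.linear_mem_faceDir hρ (ht t h hj) hu⟩⟩
  rw [Submodule.coe_sub, faceModel_coe, faceModel_coe, sub_sub_sub_cancel_right,
    LinearMap.coe_toContinuousLinearMap', LinearMap.coe_restrict_apply, Submodule.coe_sub,
    faceModel_coe, faceModel_coe, sub_sub_sub_cancel_right]
  exact (ρ.linearMap_vsub x y).symm

lemma isClosed_faceSet (Δ : Affine.Simplex ℝ V k) (s : SimplexFace k) :
    IsClosed (Δ.faceSet s) :=
  ((s.1.finite_toSet.image Δ.points).isCompact_convexHull ℝ).isClosed

lemma compactSpace_faceSet (Δ : Affine.Simplex ℝ V k) (s : SimplexFace k) :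
    CompactSpace (Δ.faceSet s) :=
  isCompact_iff_compactSpace.1 ((s.1.finite_toSet.image Δ.points).isCompact_convexHull ℝ)

end Affine.Simplex
end FaceMaps

/-! ### Families of forms on the fibres of `A`, and extension near a point. -/

section LocalExtension

variable {V : Type*} [NormedAddCommGroup V] [NormedSpace ℝ V] {k : ℕ}
  {Δ : Affine.Simplex ℝ V k}
  {F : Type*} [NormedAddCommGroup F] [NormedSpace ℝ F]
  {A : Δ.faceSet (SimplexFace.whole k) → Type*} [TopologicalSpace (TotalSpace F A)]
  [∀ x, AddCommGroup (A x)] [∀ x, Module ℝ (A x)] [∀ x, TopologicalSpace (A x)]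
  [FiberBundle F A]

namespace LieAlgebroid

variable {p : ℕ}

variable (F) in
/-- A family of alternating forms on the fibres of `A` is smooth at a point if it is smooth on
sections of `A` along smooth maps from faces of the simplex. -/
def SmoothFamilyAt
    (η : ∀ x, A x [⋀^Fin p]→ₗ[ℝ] ℝ) (x₀ : Δ.faceSet (SimplexFace.whole k)) : Prop :=
  ∀ (t : SimplexFace k) (g : Δ.faceSet t → Δ.faceSet (SimplexFace.whole k)),
    ContMDiff (Δ.faceModel t) (Δ.faceModel (SimplexFace.whole k)) ∞ g →
    ∀ (y : Δ.faceSet t), g y = x₀ → ∀ X : Fin p → ∀ y, A (g y),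
    (∀ i, ContMDiffAt (Δ.faceModel t) ((Δ.faceModel (SimplexFace.whole k)).prod 𝓘(ℝ, F)) ∞
      (fun y => (⟨g y, X i y⟩ : TotalSpace F A)) y) →
    ContMDiffAt (Δ.faceModel t) 𝓘(ℝ, ℝ) ∞ (fun y => η (g y) (fun i => X i y)) y

lemma SmoothFamilyAt.add {η η' : ∀ x, A x [⋀^Fin p]→ₗ[ℝ] ℝ}
    {x₀ : Δ.faceSet (SimplexFace.whole k)} (h : SmoothFamilyAt F η x₀)
    (h' : SmoothFamilyAt F η' x₀) : SmoothFamilyAt F (fun x => η x + η' x) x₀ :=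
  fun t g hg y hy X hX => (h t g hg y hy X hX).add (h' t g hg y hy X hX)

lemma smoothFamilyAt_zero (x₀ : Δ.faceSet (SimplexFace.whole k)) :
    SmoothFamilyAt F (fun x => (0 : A x [⋀^Fin p]→ₗ[ℝ] ℝ)) x₀ :=
  fun _ _ _ _ _ _ _ => contMDiffAt_const

variable [VectorBundle ℝ F A] [ContMDiffVectorBundle ∞ F A (Δ.faceModel (SimplexFace.whole k))]

/-- The anchor, with values in the direction of the simplex. -/
noncomputable def simplexAnchor (L : LieAlgebroid (Δ.faceModel (SimplexFace.whole k)) F A)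
    (x : Δ.faceSet (SimplexFace.whole k)) : A x →ₗ[ℝ] Δ.faceDir (SimplexFace.whole k) :=
  L.anchor x

lemma contMDiff_simplexAnchor (L : LieAlgebroid (Δ.faceModel (SimplexFace.whole k)) F A) :
    ContMDiff ((Δ.faceModel (SimplexFace.whole k)).prod 𝓘(ℝ, F))
      𝓘(ℝ, Δ.faceDir (SimplexFace.whole k)) ∞
      (fun a : TotalSpace F A => L.simplexAnchor a.1 a.2) :=
  (contMDiff_snd_tangentBundle_modelSpace _ (Δ.faceModel (SimplexFace.whole k))).comp
    L.contMDiff_anchor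

/-- The derivative of the inclusion of a face is the inclusion of its direction. Tangency thus
becomes membership in a subspace of the fixed space `V`, so that different faces can be compared. -/
lemma mem_faceFibre_iff (L : LieAlgebroid (Δ.faceModel (SimplexFace.whole k)) F A)
    {s : SimplexFace k} {x : Δ.faceSet s} {a : A (Δ.faceIncl s.le_whole x)} :
    a ∈ L.faceFibre s x ↔ (L.simplexAnchor _ a : V) ∈ Δ.faceDir s := by
  have h : ∀ u : Δ.faceDir s, (mfderiv (Δ.faceModel s) (Δ.faceModel (SimplexFace.whole k))
      (Δ.faceIncl s.le_whole) x u = L.anchor _ a) ↔ (u : V) = (L.simplexAnchor _ a : V) := fun u => by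
    rw [Δ.mfderiv_faceIncl s.le_whole x u]
    exact Subtype.ext_iff
  constructor
  · rintro ⟨u, hu⟩
    rw [← (h u).1 hu]
    exact u.2
  · exact fun ha => ⟨⟨_, ha⟩, (h ⟨_, ha⟩).2 rfl⟩

lemma SmoothForm.ext_toFun {L : LieAlgebroid (Δ.faceModel (SimplexFace.whole k)) F A}
    {s : SimplexFace k} {p : ℕ} {ξ η : L.FaceForm s p} (h : ∀ x, ξ.toFun x = η.toFun x) :
    ξ = η := by
  cases ξ; cases η
  congr
  exact funext h

/-- The restriction of a family of forms on `A` to a face. -/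
noncomputable def restrictFamily (L : LieAlgebroid (Δ.faceModel (SimplexFace.whole k)) F A)
    (η : ∀ x, A x [⋀^Fin p]→ₗ[ℝ] ℝ) (s : SimplexFace k) (y : Δ.faceSet s) :
    (L.faceFibre s y) [⋀^Fin p]→ₗ[ℝ] ℝ :=
  (η (Δ.faceIncl s.le_whole y)).compLinearMap (L.faceFibre s y).subtype

lemma alternatingMap_restrict_restrict {N : Type*} [AddCommGroup N] [Module ℝ N]
    (f : N [⋀^Fin p]→ₗ[ℝ] ℝ) {S T : Submodule ℝ N} (h : S ≤ T) :
    (f.compLinearMap T.subtype).compLinearMap (Submodule.inclusion h) =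
      f.compLinearMap S.subtype := rfl

lemma restrictFamily_apply (L : LieAlgebroid (Δ.faceModel (SimplexFace.whole k)) F A)
    (η : ∀ x, A x [⋀^Fin p]→ₗ[ℝ] ℝ) (s : SimplexFace k) (y : Δ.faceSet s)
    (v : Fin p → L.faceFibre s y) :
    L.restrictFamily η s y v = η (Δ.faceIncl s.le_whole y) (fun q => (v q).1) := rfl

/-- This is the compatibility that makes the restrictions of a single family a piecewise smooth
form. -/
lemma restrictFamily_comp_inclusion (L : LieAlgebroid (Δ.faceModel (SimplexFace.whole k)) F A)
    (η : ∀ x, A x [⋀^Fin p]→ₗ[ℝ] ℝ) {s t : SimplexFace k} (h : t ≤ s) (x : Δ.faceSet t) :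
    (L.restrictFamily η s (Δ.faceIncl h x)).compLinearMap
      (Submodule.inclusion (L.faceFibre_le h x)) = L.restrictFamily η t x :=
  alternatingMap_restrict_restrict (η (Δ.faceIncl t.le_whole x)) (L.faceFibre_le h x)

/-- Used at `y = r x`, which lies in the smaller face without being given as an included point;
hence the hypothesis quantifies over the `z` with `Δ.faceIncl h z = y`. -/
lemma eq_of_comp_inclusion_eq (L : LieAlgebroid (Δ.faceModel (SimplexFace.whole k)) F A)
    {s t : SimplexFace k} (h : t ≤ s) {α β : ∀ y : Δ.faceSet s, (L.faceFibre s y) [⋀^Fin p]→ₗ[ℝ] ℝ}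
    {y : Δ.faceSet s} (hy : (y : V) ∈ Δ.faceSet t)
    (hαβ : ∀ z : Δ.faceSet t, Δ.faceIncl h z = y →
      (α (Δ.faceIncl h z)).compLinearMap (Submodule.inclusion (L.faceFibre_le h z)) =
        (β (Δ.faceIncl h z)).compLinearMap (Submodule.inclusion (L.faceFibre_le h z)))
    (w : Fin p → L.faceFibre s y)
    (hw : ∀ q, (L.simplexAnchor _ (w q).1 : V) ∈ Δ.faceDir t) : α y w = β y w := by
  obtain ⟨z, rfl⟩ : ∃ z : Δ.faceSet t, Δ.faceIncl h z = y := ⟨⟨y, hy⟩, rfl⟩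
  have hw' : ∀ q, (w q).1 ∈ L.faceFibre t z := fun q => L.mem_faceFibre_iff.2 (hw q)
  exact DFunLike.congr_fun (hαβ z rfl) fun q => ⟨(w q).1, hw' q⟩

/-- A family of forms on the restriction of `A` to a face is smooth on `U`. -/
def SmoothFaceFamilyOn (L : LieAlgebroid (Δ.faceModel (SimplexFace.whole k)) F A)
    {s : SimplexFace k} (ζ : ∀ y : Δ.faceSet s, (L.faceFibre s y) [⋀^Fin p]→ₗ[ℝ] ℝ)
    (U : Set (Δ.faceSet s)) : Prop :=
  ∀ Y : Fin p → ∀ y, L.faceFibre s y,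
    (∀ i, L.SmoothSectionOn (Δ.faceModel s) (Δ.faceIncl s.le_whole) (Y i) U) →
    ContMDiffOn (Δ.faceModel s) 𝓘(ℝ, ℝ) ∞ (fun y => ζ y (fun i => Y i y)) U

/-- The inclusion of the face is one of the test maps in `SmoothFamilyAt`. -/
lemma smoothFaceFamilyOn_restrictFamily
    (L : LieAlgebroid (Δ.faceModel (SimplexFace.whole k)) F A)
    {η : ∀ x, A x [⋀^Fin p]→ₗ[ℝ] ℝ} {s : SimplexFace k} {U : Set (Δ.faceSet s)} (hU : IsOpen U)
    (hη : ∀ y ∈ U, SmoothFamilyAt F η (Δ.faceIncl s.le_whole y)) :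
    L.SmoothFaceFamilyOn (L.restrictFamily η s) U := fun Y hY y hy =>
  (hη y hy s _ (Δ.contMDiff_faceIncl s.le_whole) y rfl (fun i y => (Y i y).1)
    fun i => (hY i).contMDiffAt (hU.mem_nhds hy)).contMDiffWithinAt

lemma multilinear_expand {ι C M : Type*} [Fintype ι] [DecidableEq ι] [Fintype C] [AddCommGroup M]
    [Module ℝ M] (ζ : M [⋀^ι]→ₗ[ℝ] ℝ) (a : ι → C → ℝ) (v : C → M) :
    ζ (fun i => ∑ c, a i c • v c) = ∑ f : ι → C, (∏ i, a i (f i)) * ζ (fun i => v (f i)) := by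
  rw [← AlternatingMap.coe_multilinearMap, MultilinearMap.map_sum]
  refine Finset.sum_congr rfl fun f _ => ?_
  rw [MultilinearMap.map_smul_univ, smul_eq_mul]

/-- The linear maps `A x → A_s (r x)` given by a frame of the restriction of `A` to a face `s`. -/
noncomputable def frameTransport (L : LieAlgebroid (Δ.faceModel (SimplexFace.whole k)) F A)
    {s : SimplexFace k} (r : Δ.faceSet (SimplexFace.whole k) → Δ.faceSet s) {C : Type} [Fintype C]
    (θ : C → ∀ x, A x →ₗ[ℝ] ℝ) (σ : C → ∀ y : Δ.faceSet s, L.faceFibre s y)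
    (x : Δ.faceSet (SimplexFace.whole k)) : A x →ₗ[ℝ] L.faceFibre s (r x) :=
  ∑ c, (θ c x).smulRight (σ c (r x))

lemma frameTransport_apply (L : LieAlgebroid (Δ.faceModel (SimplexFace.whole k)) F A)
    {s : SimplexFace k} (r : Δ.faceSet (SimplexFace.whole k) → Δ.faceSet s) {C : Type} [Fintype C]
    (θ : C → ∀ x, A x →ₗ[ℝ] ℝ) (σ : C → ∀ y : Δ.faceSet s, L.faceFibre s y)
    (x : Δ.faceSet (SimplexFace.whole k)) (a : A x) :
    L.frameTransport r θ σ x a = ∑ c, θ c x a • σ c (r x) := by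
  simp [frameTransport]

/-- Expanding by multilinearity over the frame leaves finitely many products of coefficients `θ c (X
i)`, smooth along the test map, with values of `ζ` on the sections `σ c`, smooth on `U` and composed
with `r`. -/
lemma smoothFamilyAt_pullback (L : LieAlgebroid (Δ.faceModel (SimplexFace.whole k)) F A)
    {s : SimplexFace k} {r : Δ.faceSet (SimplexFace.whole k) → Δ.faceSet s}
    (hr : ContMDiff (Δ.faceModel (SimplexFace.whole k)) (Δ.faceModel s) ∞ r)
    {C : Type} [Fintype C]
    {θ : C → ∀ x, A x →ₗ[ℝ] ℝ} {σ : C → ∀ y : Δ.faceSet s, L.faceFibre s y}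
    {W : Set (Δ.faceSet (SimplexFace.whole k))} (hW : IsOpen W)
    (hθ : ∀ c, ContMDiffOn ((Δ.faceModel (SimplexFace.whole k)).prod 𝓘(ℝ, F)) 𝓘(ℝ, ℝ) ∞
      (fun a : TotalSpace F A => θ c a.1 a.2) (TotalSpace.proj ⁻¹' W))
    {U : Set (Δ.faceSet s)} (hU : IsOpen U)
    (hσ : ∀ c, L.SmoothSectionOn (Δ.faceModel s) (Δ.faceIncl s.le_whole) (σ c) U)
    {ζ : ∀ y : Δ.faceSet s, (L.faceFibre s y) [⋀^Fin p]→ₗ[ℝ] ℝ} (hζ : L.SmoothFaceFamilyOn ζ U)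
    {x₀ : Δ.faceSet (SimplexFace.whole k)} (hx₀ : x₀ ∈ W) (hrx₀ : r x₀ ∈ U) :
    SmoothFamilyAt F (fun x => (ζ (r x)).compLinearMap (L.frameTransport r θ σ x)) x₀ := by
  classical
  rintro t g hg y rfl X hX
  simp only [AlternatingMap.compLinearMap_apply, frameTransport_apply, multilinear_expand]
  refine contMDiffAt_finsetSum fun f _ => ContMDiffAt.mul ?_ ?_
  · refine contMDiffAt_finsetProd fun i _ => ?_
    have h1 : ContMDiffAt ((Δ.faceModel (SimplexFace.whole k)).prod 𝓘(ℝ, F)) 𝓘(ℝ, ℝ) ∞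
        (fun a : TotalSpace F A => θ (f i) a.1 a.2) ⟨g y, X i y⟩ :=
      (hθ (f i)).contMDiffAt
        ((hW.preimage (FiberBundle.continuous_proj F A)).mem_nhds hx₀)
    exact h1.comp y (hX i)
  · have h1 := (hζ (fun i => σ (f i)) fun i => hσ (f i)).contMDiffAt (hU.mem_nhds hrx₀)
    exact h1.comp y ((hr.comp hg) y)

variable [FiniteDimensional ℝ F]

/-- Extension of compatible forms from some of the faces of codimension one to a neighbourhood of
a point. -/
lemma exists_local_extension (L : LieAlgebroid (Δ.faceModel (SimplexFace.whole k)) F A)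
    (hL : L.IsTransitive) (J : Set (SimplexFace k)) (hJ : ∀ s ∈ J, s.dim + 1 = k)
    (ξ : ∀ s : J, L.FaceForm (s : SimplexFace k) p)
    (hξ : ∀ (s t : J) (h : ((s : SimplexFace k).1 ∩ (t : SimplexFace k).1).Nonempty)
      (x : Δ.faceSet (SimplexFace.inter s.1 t.1 h)),
      (ξ s).restrict (SimplexFace.inter_le_left s.1 t.1 h) x =
        (ξ t).restrict (SimplexFace.inter_le_right s.1 t.1 h) x)
    (x₀ : Δ.faceSet (SimplexFace.whole k)) :
    ∃ W : Set (Δ.faceSet (SimplexFace.whole k)), IsOpen W ∧ x₀ ∈ W ∧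
      ∃ η : ∀ x, A x [⋀^Fin p]→ₗ[ℝ] ℝ, (∀ x ∈ W, SmoothFamilyAt F η x) ∧
        ∀ (s : J) (y : Δ.faceSet s.1), Δ.faceIncl s.1.le_whole y ∈ W →
          L.restrictFamily η s.1 y = (ξ s).toFun y := by
  classical
  obtain ⟨j, hj⟩ := Δ.exists_forall_notMem_faceSet x₀.2
  suffices H : ∀ T : Finset J, ∃ W : Set (Δ.faceSet (SimplexFace.whole k)), IsOpen W ∧ x₀ ∈ W ∧
      ∃ η : ∀ x, A x [⋀^Fin p]→ₗ[ℝ] ℝ, (∀ x ∈ W, SmoothFamilyAt F η x) ∧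
        ∀ s ∈ T, ∀ (y : Δ.faceSet s.1), Δ.faceIncl s.1.le_whole y ∈ W →
          L.restrictFamily η s.1 y = (ξ s).toFun y by
    obtain ⟨W, hW, hx₀, η, hη, h⟩ := H Finset.univ
    exact ⟨W, hW, hx₀, η, hη, fun s => h s (Finset.mem_univ s)⟩
  have hopen : ∀ s : SimplexFace k,
      IsOpen {x : Δ.faceSet (SimplexFace.whole k) | (x : V) ∉ Δ.faceSet s} := fun s =>
    (Δ.isClosed_faceSet s).isOpen_compl.preimage continuous_subtype_val
  intro T
  induction T using Finset.induction_on with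
  | empty =>
    exact ⟨univ, isOpen_univ, mem_univ _, fun x => 0, fun x _ => smoothFamilyAt_zero x, by simp⟩
  | insert s T hsT ih =>
  obtain ⟨W, hW, hx₀, η, hη, hT⟩ := ih
  by_cases hxs : (x₀ : V) ∉ Δ.faceSet s.1
  · refine ⟨W ∩ {x | (x : V) ∉ Δ.faceSet s.1}, hW.inter (hopen s.1), ⟨hx₀, hxs⟩, η,
      fun x hx => hη x hx.1, fun t ht y hy => ?_⟩
    rcases Finset.mem_insert.1 ht with rfl | ht
    · exact absurd y.2 hy.2
    · exact hT t ht y hy.1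
  rw [not_not] at hxs
  -- A face of codimension one omits exactly one vertex. Since `dim` is a truncated subtraction,
  -- nonemptiness of the face is needed for the count.
  obtain ⟨i, hi⟩ : ∃ i, ∀ m, m ∈ s.1.1 ↔ m ≠ i := by
    have h1 := hJ s.1 s.2
    have h2 : 0 < s.1.1.card := Finset.card_pos.2 s.1.2
    have h3 : (s.1.1)ᶜ.card = 1 := by
      rw [Finset.card_compl, Fintype.card_fin]
      unfold SimplexFace.dim at h1
      omega
    obtain ⟨i, hi⟩ := Finset.card_eq_one.1 h3
    refine ⟨i, fun m => ?_⟩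
    rw [← Finset.notMem_compl, hi, Finset.mem_singleton]
  have hjs : j ∈ s.1.1 := by
    by_contra h
    exact hj s.1 h hxs
  obtain ⟨r, R, hr, hRs, hR, hrs, ht⟩ := Δ.exists_retraction ((hi j).1 hjs) hi
  obtain ⟨W₁, hW₁, hx₁, C, _, θ, τ, hθ, hτ, hτs, hΦ, hΦs⟩ :=
    exists_transport_frame (I := Δ.faceModel (SimplexFace.whole k)) L.simplexAnchor
      L.contMDiff_simplexAnchor x₀ (hL x₀)
      ((Δ.faceDir s.1).comap (Δ.faceDir (SimplexFace.whole k)).subtype) R hRs hR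
  let σ : C → ∀ y : Δ.faceSet s.1, L.faceFibre s.1 y := fun c y =>
    ⟨τ c _, L.mem_faceFibre_iff.2 (hτs c _)⟩
  -- The defect of `η` on the new face.
  let ζ : ∀ y : Δ.faceSet s.1, (L.faceFibre s.1 y) [⋀^Fin p]→ₗ[ℝ] ℝ := fun y =>
    (ξ s).toFun y - L.restrictFamily η s.1 y
  have hincl := (Δ.contMDiff_faceIncl s.1.le_whole).continuous
  let U : Set (Δ.faceSet s.1) := Δ.faceIncl s.1.le_whole ⁻¹' (W ∩ W₁)
  have hU : IsOpen U := (hW.inter hW₁).preimage hincl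
  have hσ : ∀ c, L.SmoothSectionOn (Δ.faceModel s.1) (Δ.faceIncl s.1.le_whole) (σ c) U :=
    fun c => (hτ c).comp (Δ.contMDiff_faceIncl s.1.le_whole).contMDiffOn fun y hy => hy.2
  have hζ : L.SmoothFaceFamilyOn ζ U := fun Y hY =>
    ((ξ s).smooth U hU Y hY).sub
      (L.smoothFaceFamilyOn_restrictFamily hU (fun y hy => hη _ hy.1) Y hY)
  -- Near `x₀`: `η` and the frame are good at `x` and also at `r x`, and no face omitting `j` is
  -- met.
  let W' : Set (Δ.faceSet (SimplexFace.whole k)) :=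
    (W ∩ W₁) ∩ r ⁻¹' U ∩ ⋂ t ∈ {t : SimplexFace k | j ∉ t.1}, {x | (x : V) ∉ Δ.faceSet t}
  have hW' : IsOpen W' := ((hW.inter hW₁).inter (hU.preimage hr.continuous)).inter
    ((Set.toFinite _).isOpen_biInter fun t _ => hopen t)
  have hrx₀ : Δ.faceIncl s.1.le_whole (r x₀) = x₀ := by
    have := hrs ⟨x₀, hxs⟩
    exact congrArg (Δ.faceIncl s.1.le_whole) this
  refine ⟨W', hW', ⟨⟨⟨hx₀, hx₁⟩, ?_⟩, mem_iInter₂.2 fun t ht => hj t ht⟩,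
    fun x => η x + (ζ (r x)).compLinearMap (L.frameTransport r θ σ x), fun x hx =>
      (hη x hx.1.1.1).add (L.smoothFamilyAt_pullback hr hW₁ hθ hU hσ hζ hx.1.1.2 hx.1.2), ?_⟩
  · change Δ.faceIncl s.1.le_whole (r x₀) ∈ W ∩ W₁
    rw [hrx₀]
    exact ⟨hx₀, hx₁⟩
  intro t htT y hy
  rcases Finset.mem_insert.1 htT with rfl | htT
  · ext v
    -- The retraction fixes `y` only up to a propositional equality on which the type of the fibre
    -- depends, hence the general `z`.
    have key : ∀ z, z = y → (ζ z) (fun q => ∑ c, θ c _ (v q).1 • σ c z) = ζ y v := by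
      rintro z rfl
      congr 1
      funext q
      refine Subtype.ext ?_
      rw [Submodule.coe_sum]
      exact hΦs _ hy.1.1.2 _ (L.mem_faceFibre_iff.1 (v q).2)
    have h1 := key _ (hrs y)
    change η _ (fun q => (v q).1) + ζ (r _) (fun q => L.frameTransport r θ σ _ (v q).1) = _
    simp only [frameTransport_apply]
    rw [h1]
    change η _ (fun q => (v q).1) + ((ξ t).toFun y v - η _ (fun q => (v q).1)) = _
    abel
  · have hjt : j ∈ t.1.1 := by
      by_contra h
      exact mem_iInter₂.1 hy.2 t.1 h y.2
    have hst : (s.1.1 ∩ t.1.1).Nonempty := ⟨j, Finset.mem_inter.2 ⟨hjs, hjt⟩⟩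
    obtain ⟨hr₂, hR₂⟩ := ht t.1 hst hjt
    rw [← hT t htT y hy.1.1.1]
    -- The correction vanishes on `t`: transported vectors have anchor `R (Γ x a)`, tangent to `s ∩
    -- t`, and there `ξ s`, `ξ t` and `η` coincide.
    have hzero : ∀ v : Fin p → A (Δ.faceIncl t.1.le_whole y), (∀ q, v q ∈ L.faceFibre t.1 y) →
        ζ (r (Δ.faceIncl t.1.le_whole y)) (fun q => L.frameTransport r θ σ _ (v q)) = 0 := by
      intro v hv
      have hrU := hy.1.2
      have hmem : ∀ q, (L.simplexAnchor _ (L.frameTransport r θ σ _ (v q)).1 : V) ∈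
          Δ.faceDir (s.1.inter t.1 hst) := fun q => by
        have h1 := hR₂ _ (L.mem_faceFibre_iff.1 (hv q))
        rw [← hΦ _ hy.1.1.2 _ hrU.2] at h1
        rw [frameTransport_apply, Submodule.coe_sum]
        exact h1
      refine sub_eq_zero.2 (L.eq_of_comp_inclusion_eq (SimplexFace.inter_le_left s.1 t.1 hst)
        (α := (ξ s).toFun) (β := L.restrictFamily η s.1) (hr₂ _ y.2) (fun z hz => ?_) _ hmem)
      have hzW : Δ.faceIncl s.1.le_whole (Δ.faceIncl
          (SimplexFace.inter_le_left s.1 t.1 hst) z) ∈ W := by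
        rw [hz]
        exact hrU.1
      rw [L.restrictFamily_comp_inclusion,
        ← L.restrictFamily_comp_inclusion η (SimplexFace.inter_le_right s.1 t.1 hst),
        hT t htT (Δ.faceIncl (SimplexFace.inter_le_right s.1 t.1 hst) z) hzW]
      exact hξ s t hst z
    ext v
    change η _ (fun q => (v q).1) + ζ (r _) (fun q => L.frameTransport r θ σ _ (v q).1) = _
    rw [hzero _ fun q => (v q).2, add_zero]
    rfl

end LieAlgebroid
end LocalExtension

/-! ### Gluing by a partition of unity. -/

section Gluing

variable {V : Type*} [NormedAddCommGroup V] [NormedSpace ℝ V] {k : ℕ}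
  {Δ : Affine.Simplex ℝ V k}
  {F : Type*} [NormedAddCommGroup F] [NormedSpace ℝ F]
  {A : Δ.faceSet (SimplexFace.whole k) → Type*} [TopologicalSpace (TotalSpace F A)]
  [∀ x, AddCommGroup (A x)] [∀ x, Module ℝ (A x)] [∀ x, TopologicalSpace (A x)]
  [FiberBundle F A] {p : ℕ}

namespace LieAlgebroid

lemma alternatingMap_sum_apply {ι N : Type*} [AddCommGroup N] [Module ℝ N] (s : Finset ι)
    (f : ι → N [⋀^Fin p]→ₗ[ℝ] ℝ) (v : Fin p → N) : (∑ i ∈ s, f i) v = ∑ i ∈ s, f i v :=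
  map_sum (⟨⟨fun g => g v, rfl⟩, fun _ _ => rfl⟩ : (N [⋀^Fin p]→ₗ[ℝ] ℝ) →+ ℝ) f s

lemma smoothFamilyAt_partitionOfUnity {ι : Type*}
    (f : SmoothPartitionOfUnity ι (Δ.faceModel (SimplexFace.whole k))
      (Δ.faceSet (SimplexFace.whole k)) univ)
    {η : ι → ∀ x, A x [⋀^Fin p]→ₗ[ℝ] ℝ} {x₀ : Δ.faceSet (SimplexFace.whole k)}
    (hη : ∀ i, x₀ ∈ tsupport (f i) → SmoothFamilyAt F (η i) x₀) :
    SmoothFamilyAt F (fun x => ∑ i ∈ f.finsupport x, f i x • η i x) x₀ := by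
  rintro t g hg y rfl X hX
  -- The index set `f.finsupport (g z)` varies with `z`; a locally finite `finsum` over all indices
  -- removes this dependence.
  have h1 : ∀ z, (∑ i ∈ f.finsupport (g z), f i (g z) • η i (g z)) (fun i => X i z) =
      ∑ᶠ i, f i (g z) * η i (g z) (fun i => X i z) := fun z => by
    rw [alternatingMap_sum_apply]
    simp only [AlternatingMap.smul_apply, smul_eq_mul]
    refine (finsum_eq_sum_of_support_subset _ fun i hi => ?_).symm
    rw [f.coe_finsupport]
    exact fun h => hi (by simp [h])
  simp only [h1]
  have hlf : LocallyFinite fun i => Function.support fun z => f i (g z) :=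
    f.locallyFinite.preimage_continuous hg.continuous
  refine contMDiffAt_finsum (hlf.subset fun i z hz => ?_) fun i => ?_
  · exact fun h => hz (by simp [h])
  · by_cases hi : g y ∈ tsupport (f i)
    · exact ContMDiffAt.mul (((f i).contMDiff.comp hg) y) (hη i hi t g hg y rfl X hX)
    · refine (contMDiffAt_const (c := (0 : ℝ))).congr_of_eventuallyEq ?_
      filter_upwards [hg.continuous.continuousAt.preimage_mem_nhds
        ((isClosed_tsupport (f i)).isOpen_compl.mem_nhds hi)] with z hz
      simp [image_eq_zero_of_notMem_tsupport hz]

variable [VectorBundle ℝ F A] [ContMDiffVectorBundle ∞ F A (Δ.faceModel (SimplexFace.whole k))]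

/-- A smooth family of forms on `A` restricts to a piecewise smooth form. -/
noncomputable def PiecewiseSmoothForm.ofFamily
    (L : LieAlgebroid (Δ.faceModel (SimplexFace.whole k)) F A)
    (η : ∀ x, A x [⋀^Fin p]→ₗ[ℝ] ℝ) (hη : ∀ x, SmoothFamilyAt F η x) :
    L.PiecewiseSmoothForm p where
  form s :=
    { toFun := L.restrictFamily η s
      smooth := fun _ hU => L.smoothFaceFamilyOn_restrictFamily hU fun _ _ => hη _ }
  compat _ _ h x := L.restrictFamily_comp_inclusion η h x

lemma exists_global_extension [FiniteDimensional ℝ F]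
    (L : LieAlgebroid (Δ.faceModel (SimplexFace.whole k)) F A)
    (hL : L.IsTransitive) (J : Set (SimplexFace k)) (hJ : ∀ s ∈ J, s.dim + 1 = k)
    (ξ : ∀ s : J, L.FaceForm (s : SimplexFace k) p)
    (hξ : ∀ (s t : J) (h : ((s : SimplexFace k).1 ∩ (t : SimplexFace k).1).Nonempty)
      (x : Δ.faceSet (SimplexFace.inter s.1 t.1 h)),
      (ξ s).restrict (SimplexFace.inter_le_left s.1 t.1 h) x =
        (ξ t).restrict (SimplexFace.inter_le_right s.1 t.1 h) x) :
    ∃ η : ∀ x, A x [⋀^Fin p]→ₗ[ℝ] ℝ, (∀ x, SmoothFamilyAt F η x) ∧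
      ∀ (s : J) (y : Δ.faceSet s.1), L.restrictFamily η s.1 y = (ξ s).toFun y := by
  choose W hW hxW η hη hηξ using L.exists_local_extension hL J hJ ξ hξ
  -- Compactness gives the σ-compactness required for a partition of unity.
  have := Δ.compactSpace_faceSet (SimplexFace.whole k)
  obtain ⟨f, hf⟩ := SmoothPartitionOfUnity.exists_isSubordinate
    (Δ.faceModel (SimplexFace.whole k)) isClosed_univ W hW
    fun x _ => mem_iUnion.2 ⟨x, hxW x⟩
  refine ⟨fun x => ∑ c ∈ f.finsupport x, f c x • η c x, fun x =>
    smoothFamilyAt_partitionOfUnity f fun c hc => hη c x (hf c hc), fun s y => ?_⟩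
  ext v
  have h1 : ∀ c ∈ f.finsupport (Δ.faceIncl s.1.le_whole y),
      η c (Δ.faceIncl s.1.le_whole y) (fun q => (v q).1) = (ξ s).toFun y v := fun c hc => by
    rw [← hηξ c s y (hf c (subset_tsupport _ ((f.mem_finsupport _).1 hc)))]
    rw [restrictFamily_apply]
  rw [restrictFamily_apply, alternatingMap_sum_apply]
  simp only [AlternatingMap.smul_apply]
  -- Every term with nonzero weight has the same value `(ξ s).toFun y v`, and the weights sum to
  -- one.
  rw [Finset.sum_congr rfl fun c hc => by rw [h1 c hc], ← Finset.sum_smul]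
  have h2 := f.sum_finsupport (Δ.faceIncl s.1.le_whole y) (mem_univ _)
  exact (congrArg (· • (ξ s).toFun y v) h2).trans (one_smul ℝ _)

end LieAlgebroid
end Gluing

theorem proposition3p3
    {V : Type*} [NormedAddCommGroup V] [NormedSpace ℝ V]
    -- the simplex, of dimension `k`
    {k : ℕ} (Δ : Affine.Simplex ℝ V k)
    -- the smooth vector bundle `A` of finite rank on the simplex
    {F : Type*} [NormedAddCommGroup F] [NormedSpace ℝ F] [FiniteDimensional ℝ F]
    (A : Δ.faceSet (SimplexFace.whole k) → Type*) [TopologicalSpace (TotalSpace F A)]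
    [∀ x, AddCommGroup (A x)] [∀ x, Module ℝ (A x)] [∀ x, TopologicalSpace (A x)]
    [FiberBundle F A] [VectorBundle ℝ F A]
    [ContMDiffVectorBundle ∞ F A (Δ.faceModel (SimplexFace.whole k))]
    -- a transitive Lie algebroid structure on `A`
    (L : LieAlgebroid (Δ.faceModel (SimplexFace.whole k)) F A) (hL : L.IsTransitive)
    (p : ℕ)
    -- some of the faces of dimension `k - 1`, and a smooth form on each of them
    (J : Set (SimplexFace k)) (hJ : ∀ s ∈ J, s.dim + 1 = k)
    (ξ : ∀ s : J, L.FaceForm (s : SimplexFace k) p)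
    -- the forms agree on the nonempty intersections
    (hξ : ∀ (s t : J) (h : ((s : SimplexFace k).1 ∩ (t : SimplexFace k).1).Nonempty)
      (x : Δ.faceSet (SimplexFace.inter s.1 t.1 h)),
      (ξ s).restrict (SimplexFace.inter_le_left s.1 t.1 h) x =
        (ξ t).restrict (SimplexFace.inter_le_right s.1 t.1 h) x) :
    ∃ η : L.PiecewiseSmoothForm p, ∀ s : J, η.form s = ξ s := by
  obtain ⟨η, hη, h⟩ := L.exists_global_extension hL J hJ ξ hξ
  exact ⟨.ofFamily L η hη, fun s => LieAlgebroid.SmoothForm.ext_toFun (h s)⟩
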